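/- **Proposition (Asymptotic normality).** Let $X$ and $Z$ be independent random variables with values in measurable spaces $E$ and $F$ (for instance $\mathbb{R}^{p_1}$ and $\mathbb{R}^{p_2}$), let $Z'$ be a copy of $Z$ (that is, $Z'$ has the law of $Z$) independent of $(X,Z)$, let $f:E\times F\to\mathbb{R}$ be measurable, and set \[ Y=f(X,Z),\qquad Y^X=f(X,Z'). \] Assume that $\operatorname{Var}(Y)\neq 0$ and $\mathbb{E}(Y^4)<\infty$, and let \[ S^X=\frac{\operatorname{Var}(\mathbb{E}(Y\mid X))}{\operatorname{Var}(Y)} \] be the Sobol index. Let $(X_i,Z_i,Z_i')_{i\ge 1}$ be independent copies of $(X,Z,Z')$, put $Y_i=f(X_i,Z_i)$ and $Y_i^X=f(X_i,Z_i')$, and define, all sums being over $i=1,\dots,N$, \[ S^X_N=\frac{\frac1N\sum Y_iY_i^X-\left(\frac1N\sum Y_i\right)\left(\frac1N\sum Y_i^X\right)}{\frac1N\sum Y_i^2-\left(\frac1N\sum Y_i\right)^2}, \] \[ T^X_N=\frac{\frac1N\sum Y_iY_i^X-\left(\frac1N\sum \frac{Y_i+Y_i^X}{2}\right)^2}{\frac1N\sum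 \frac{Y_i^2+(Y_i^X)^2}{2}-\left(\frac1N\sum \frac{Y_i+Y_i^X}{2}\right)^2}, \] a quotient with zero denominator being given the value $0$. Then, as $N\to\infty$, \[ \sqrt N\,(S^X_N-S^X)\xrightarrow{\ \mathcal L\ }\mathcal N(0,\sigma_S^2)\qquad\text{and}\qquad \sqrt N\,(T^X_N-S^X)\xrightarrow{\ \mathcal L\ }\mathcal N(0,\sigma_T^2), \] where \[ \sigma_S^2=\frac{\operatorname{Var}\Big((Y-\mathbb{E}(Y))\big[(Y^X-\mathbb{E}(Y))-S^X(Y-\mathbb{E}(Y))\big]\Big)}{(\operatorname{Var}(Y))^2}, \] \[ \sigma_T^2=\frac{\operatorname{Var}\Big((Y-\mathbb{E}(Y))(Y^X-\mathbb{E}(Y))-\frac{S^X}{2}\big((Y-\mathbb{E}(Y))^2+(Y^X-\mathbb{E}(Y))^2\big)\Big)}{(\operatorname{Var}(Y))^2}, \] and $\mathcal N(0,0)$ denotes the Dirac mass at $0$. -/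

import Mathlib

open MeasureTheory ProbabilityTheory Filter

noncomputable section

/-- The (closed) Sobol index of the output `Y` with respect to the input `X`:
`Var(E(Y | X)) / Var(Y)`, the conditional expectation being taken with respect to the
σ-algebra generated by `X`. -/
def sobolIndex {Ω E : Type*} [MeasurableSpace Ω] [mE : MeasurableSpace E] (P : Measure Ω)
    (X : Ω → E) (Y : Ω → ℝ) : ℝ :=
  Var[P[Y | mE.comap X]; P] / Var[Y; P]

/-- The empirical mean of the first `N` terms of a real sequence. -/
def empMean (r : ℕ → ℝ) (N : ℕ) : ℝ :=
  (1 / (N : ℝ)) * ∑ i ∈ Finset.range N, r i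

/-- The estimator `S_N`, as a function of the outputs `y i` and the pick-freezed
outputs `yX i`, `i < N`. -/
def estimatorS (y yX : ℕ → ℝ) (N : ℕ) : ℝ :=
  (empMean (fun i => y i * yX i) N - empMean y N * empMean yX N) /
    (empMean (fun i => y i ^ 2) N - empMean y N ^ 2)

/-- The estimator `T_N`, as a function of the outputs `y i` and the pick-freezed
outputs `yX i`, `i < N`. -/
def estimatorT (y yX : ℕ → ℝ) (N : ℕ) : ℝ :=
  (empMean (fun i => y i * yX i) N - empMean (fun i => (y i + yX i) / 2) N ^ 2) /
    (empMean (fun i => (y i ^ 2 + yX i ^ 2) / 2) N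
      - empMean (fun i => (y i + yX i) / 2) N ^ 2)

/-- The variance `σ_S²`, for the output `Y`, its pick-freezed copy `YX` and the index `s`. -/
def sigmaSqS {Ω : Type*} [MeasurableSpace Ω] (P : Measure Ω) (Y YX : Ω → ℝ) (s : ℝ) : ℝ :=
  Var[fun ω => (Y ω - P[Y]) * ((YX ω - P[Y]) - s * (Y ω - P[Y])); P] / Var[Y; P] ^ 2

/-- The variance `σ_T²`, for the output `Y`, its pick-freezed copy `YX` and the index `s`. -/
def sigmaSqT {Ω : Type*} [MeasurableSpace Ω] (P : Measure Ω) (Y YX : Ω → ℝ) (s : ℝ) : ℝ :=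
  Var[fun ω => (Y ω - P[Y]) * (YX ω - P[Y])
      - s / 2 * ((Y ω - P[Y]) ^ 2 + (YX ω - P[Y]) ^ 2); P] / Var[Y; P] ^ 2

end

/-!
Write `m = E Y`, `V = Var Y` and `s` for the Sobol index. Given `X`, the outputs `Y` and `Y^X` are
independent with the same conditional mean, so `Cov(Y, Y^X) = Var(E(Y | X)) = s V`
(`covariance_pickFreeze`).

Each estimator is a quotient `num / den` of polynomials in empirical means, with `den → V` almost
surely by the strong law of large numbers. After centring the outputs at `m`, the error
`num - s * den` is for `N ≥ 1` exactly the empirical mean of an i.i.d. sequence `W` plus a quadratic form in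
the centred empirical means (`estimatorS_num_sub`, `estimatorT_num_sub`). The variables `W` are
those whose variance appears in `sigmaSqS` and `sigmaSqT`; they are centred by the covariance
identity, and square integrable since `Y` has a fourth moment. The quadratic form has expectation
`O(1 / N)`, so it is negligible after multiplication by `√N`
(`tendstoInMeasure_sqrt_mul_of_abs_le`). The one-dimensional central limit theorem for `W` and
Slutsky's theorem then give the limit (`tendstoInDistribution_sqrt_mul_div_sub`), so no
multivariate central limit theorem is needed. A vanishing denominator is harmless because almost
surely it occurs for finitely many `N` only.
-/

/-! ### Empirical means of i.i.d. sequences -/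

section EmpiricalMean

variable {Ω : Type*} [MeasurableSpace Ω] {P : Measure Ω}

lemma aemeasurable_empMean {U : ℕ → Ω → ℝ} (hU : ∀ i, AEMeasurable (U i) P) (N : ℕ) :
    AEMeasurable (fun ω => empMean (fun i => U i ω) N) P := by
  unfold empMean
  exact (Finset.aemeasurable_fun_sum _ fun i _ => hU i).const_mul _

variable {U V : ℕ → Ω → ℝ}

lemma ae_tendsto_empMean (hint : Integrable (U 0) P) (hindep : iIndepFun U P)
    (hident : ∀ i, IdentDistrib (U i) (U 0) P P) :
    ∀ᵐ ω ∂P, Tendsto (fun N => empMean (fun i => U i ω) N) atTop (nhds P[U 0]) := by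
  filter_upwards [strong_law_ae_real U hint (fun i j hij => hindep.indepFun hij) hident] with ω h
  refine h.congr fun N => ?_
  rw [empMean]
  ring

lemma memLp_empMean (hU : MemLp (U 0) 2 P) (hident : ∀ i, IdentDistrib (U i) (U 0) P P) (N : ℕ) :
    MemLp (fun ω => empMean (fun i => U i ω) N) 2 P := by
  unfold empMean
  exact (memLp_finsetSum _ fun i _ => (hident i).memLp_iff.2 hU).const_mul _

variable [IsProbabilityMeasure P]

lemma integral_empMean_sq (hU : MemLp (U 0) 2 P) (hU0 : P[U 0] = 0) (hindep : iIndepFun U P)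
    (hident : ∀ i, IdentDistrib (U i) (U 0) P P) (N : ℕ) :
    ∫ ω, empMean (fun i => U i ω) N ^ 2 ∂P = (1 / (N : ℝ)) * Var[U 0; P] := by
  have hL i : MemLp (U i) 2 P := (hident i).memLp_iff.2 hU
  have hmean : P[fun ω => empMean (fun i => U i ω) N] = 0 := by
    simp only [empMean]
    rw [integral_const_mul, integral_finsetSum _ fun i _ => (hL i).integrable one_le_two]
    simp [fun i => (hident i).integral_eq, hU0]
  rw [← variance_of_integral_eq_zero (memLp_empMean hU hident N).aemeasurable hmean]
  simp only [empMean]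
  rw [variance_const_mul]
  have := IndepFun.variance_sum (s := Finset.range N) (fun i _ => hL i)
    (fun i _ j _ hij => hindep.indepFun hij)
  have e : (fun ω => ∑ i ∈ Finset.range N, U i ω) = ∑ i ∈ Finset.range N, U i := by
    ext; simp
  rw [e, this]
  simp only [fun i => (hident i).variance_eq, Finset.sum_const, Finset.card_range, nsmul_eq_mul]
  rcases eq_or_ne N 0 with rfl | hN
  · simp
  · field_simp

/-- Remainders that are quadratic in centred empirical means are `o(1 / √N)` in probability,
because their expectation is `O(1 / N)`. -/
lemma tendstoInMeasure_sqrt_mul_of_abs_le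
    (hU : MemLp (U 0) 2 P) (hU0 : P[U 0] = 0) (hUindep : iIndepFun U P)
    (hUident : ∀ i, IdentDistrib (U i) (U 0) P P)
    (hV : MemLp (V 0) 2 P) (hV0 : P[V 0] = 0) (hVindep : iIndepFun V P)
    (hVident : ∀ i, IdentDistrib (V i) (V 0) P P)
    {r : ℕ → Ω → ℝ} (hr : ∀ N, AEMeasurable (r N) P) (C : ℝ)
    (hle : ∀ N ω, |r N ω| ≤
      C * (empMean (fun i => U i ω) N ^ 2 + empMean (fun i => V i ω) N ^ 2)) :
    TendstoInMeasure P (fun (N : ℕ) ω => √(N : ℝ) * r N ω) atTop (fun _ => 0) := by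
  refine tendstoInMeasure_of_tendsto_eLpNorm one_ne_zero
    (fun N => ((hr N).const_mul _).aestronglyMeasurable) aestronglyMeasurable_const ?_
  set b : ℕ → Ω → ℝ := fun N ω =>
    √(N : ℝ) * (C * (empMean (fun i => U i ω) N ^ 2 + empMean (fun i => V i ω) N ^ 2)) with hb
  have hrb (N : ℕ) (ω : Ω) : |√(N : ℝ) * r N ω| ≤ b N ω := by
    rw [abs_mul, abs_of_nonneg (Real.sqrt_nonneg _)]
    exact mul_le_mul_of_nonneg_left (hle N ω) (Real.sqrt_nonneg _)
  have hbint (N : ℕ) : Integrable (b N) P :=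
    (((memLp_empMean hU hUident N).integrable_sq.add
      (memLp_empMean hV hVident N).integrable_sq).const_mul _).const_mul _
  have hbeq (N : ℕ) : ∫ ω, b N ω ∂P = C * (Var[U 0; P] + Var[V 0; P]) * (√(N : ℝ))⁻¹ := by
    simp only [hb]
    rw [integral_const_mul, integral_const_mul,
      integral_add (memLp_empMean hU hUident N).integrable_sq
        (memLp_empMean hV hVident N).integrable_sq,
      integral_empMean_sq hU hU0 hUindep hUident, integral_empMean_sq hV hV0 hVindep hVident]
    rcases eq_or_ne N 0 with rfl | hN
    · simp
    · have h1 : √(N : ℝ) ≠ 0 := by positivity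
      have h2 : √(N : ℝ) * √(N : ℝ) = N := Real.mul_self_sqrt (by positivity)
      nth_rewrite 2 3 [← h2]
      field_simp
  have hlim : Tendsto (fun N : ℕ => ENNReal.ofReal (∫ ω, b N ω ∂P)) atTop (nhds 0) := by
    rw [← ENNReal.ofReal_zero]
    refine ENNReal.tendsto_ofReal ?_
    simp only [hbeq]
    rw [← mul_zero (C * (Var[U 0; P] + Var[V 0; P]))]
    exact (tendsto_inv_atTop_zero.comp <| Real.tendsto_sqrt_atTop.comp <|
      tendsto_natCast_atTop_atTop).const_mul _
  refine tendsto_of_tendsto_of_tendsto_of_le_of_le tendsto_const_nhds hlim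
    (fun _ => zero_le) fun N => ?_
  dsimp only
  rw [eLpNorm_one_eq_lintegral_enorm, ofReal_integral_eq_lintegral_ofReal (hbint N)
    (ae_of_all _ fun ω => (abs_nonneg _).trans (hrb N ω))]
  refine lintegral_mono fun ω => ?_
  simp only [Pi.sub_apply, sub_zero]
  rw [← ofReal_norm, Real.norm_eq_abs]
  exact ENNReal.ofReal_le_ofReal (hrb N ω)

/-- The delta method for a quotient `num / den` whose error `num - s * den` is an empirical mean
`W` up to a negligible remainder `r`. -/
theorem tendstoInDistribution_sqrt_mul_div_sub {W : ℕ → Ω → ℝ} {num den r : ℕ → Ω → ℝ} {s d : ℝ}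
    (hW : MemLp (W 0) 2 P) (hW0 : P[W 0] = 0) (hindep : iIndepFun W P)
    (hident : ∀ i, IdentDistrib (W i) (W 0) P P)
    (hnum : ∀ N, AEMeasurable (num N) P) (hden : ∀ N, AEMeasurable (den N) P)
    (hr : ∀ N, AEMeasurable (r N) P) (hd : d ≠ 0)
    (hlim : ∀ᵐ ω ∂P, Tendsto (fun N => den N ω) atTop (nhds d))
    (hrlim : TendstoInMeasure P (fun (N : ℕ) ω => √(N : ℝ) * r N ω) atTop (fun _ => 0))
    (heq : ∀ N ω, N ≠ 0 →
      num N ω - s * den N ω = empMean (fun i => W i ω) N + r N ω) :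
    TendstoInDistribution (fun (N : ℕ) ω => √(N : ℝ) * (num N ω / den N ω - s))
      atTop (id : ℝ → ℝ) (fun _ => P) (gaussianReal 0 (Var[W 0; P] / d ^ 2).toNNReal) := by
  have hvar : Var[fun ω => W 0 ω / d; P] = Var[W 0; P] / d ^ 2 := by
    simp_rw [div_eq_inv_mul]
    rw [variance_const_mul, inv_pow]
  -- Dividing `W` by `d` beforehand makes the factor left for Slutsky's theorem tend to `1`, so that
  -- the limit law needs no rescaling.
  have hclt := tendstoInDistribution_inv_sqrt_mul_sum_sub (P := P) (X := fun i ω => W i ω / d)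
    (Y := (id : ℝ → ℝ)) (P' := gaussianReal 0 (Var[W 0; P] / d ^ 2).toNNReal)
    (by simpa only [hvar] using HasLaw.id) (by simpa only [div_eq_inv_mul] using hW.const_mul d⁻¹)
    (hindep.comp (fun _ x => x / d) fun _ => by fun_prop)
    (fun i => (hident i).comp (u := fun x => x / d) (by fun_prop))
  have hmean : ∫ ω, W 0 ω / d ∂P = 0 := by rw [integral_div, hW0, zero_div]
  have hrd : TendstoInMeasure P (fun (N : ℕ) ω => √(N : ℝ) * r N ω / d) atTop (fun _ => 0) := by
    rw [tendstoInMeasure_iff_norm] at hrlim ⊢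
    intro ε hε
    refine (hrlim (ε * |d|) (by positivity)).congr fun N => ?_
    congr 1
    ext ω
    simp only [sub_zero, Set.mem_ofPred_eq, norm_div, Real.norm_eq_abs]
    rw [le_div_iff₀ (by positivity)]
  have hrat : TendstoInMeasure P (fun N ω => d / den N ω) atTop (fun _ => 1) := by
    refine tendstoInMeasure_of_tendsto_ae
      (fun N => ((hden N).const_div d).aestronglyMeasurable) ?_
    filter_upwards [hlim] with ω h
    rw [← div_self hd]
    exact tendsto_const_nhds.div h hd
  have hsum := hclt.add_of_tendstoInMeasure_const hrd fun N => ((hr N).const_mul _).div_const d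
  have hprod := hsum.continuous_comp_prodMk_of_tendstoInMeasure_const
    (g := fun x : ℝ × ℝ => x.1 * x.2) (by fun_prop) hrat fun N => (hden N).const_div d
  have hid : (fun ω : ℝ => (id ω + 0) * 1) = id := by ext; simp
  rw [hid] at hprod
  have hmeas (N : ℕ) : AEMeasurable (fun ω => √(N : ℝ) * (num N ω / den N ω - s)) P :=
    (((hnum N).div (hden N)).sub_const s).const_mul _
  refine tendstoInDistribution_of_tendstoInMeasure_sub _ _ hprod ?_ hmeas
  refine tendstoInMeasure_of_tendsto_ae
    (fun N => ((hmeas N).sub (hprod.forall_aemeasurable N)).aestronglyMeasurable) ?_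
  -- The two sequences agree as soon as the denominator is nonzero; for `N = 0` both vanish.
  filter_upwards [hlim] with ω h
  refine tendsto_const_nhds.congr' ?_
  filter_upwards [h.eventually_ne hd] with N hN
  simp only [Pi.sub_apply, Pi.add_apply, Pi.zero_apply, hmean, mul_zero, sub_zero]
  rcases eq_or_ne N 0 with rfl | hN0
  · simp
  have h1 : √(N : ℝ) ≠ 0 := by positivity
  have h2 : (N : ℝ) = √(N : ℝ) * √(N : ℝ) := (Real.mul_self_sqrt (by positivity)).symm
  have h3 : num N ω / den N ω - s = (num N ω - s * den N ω) / den N ω := by field_simp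
  rw [h3, heq N ω hN0, empMean, ← Finset.sum_div]
  generalize √(N : ℝ) = q at h1 h2
  rw [h2]
  field_simp
  ring

end EmpiricalMean

/-! ### The covariance of pick-freeze outputs -/

section PickFreeze

variable {Ω E F : Type*} [MeasurableSpace Ω] [mE : MeasurableSpace E] [MeasurableSpace F]
  {P : Measure Ω} [IsProbabilityMeasure P] {X : Ω → E} {Z Z' : Ω → F} {f : E × F → ℝ}

/-- Averaging out an independent variable computes the conditional expectation. -/
lemma condExp_comp_prodMk_ae_eq_of_indepFun (hX : Measurable X) (hZ : Measurable Z)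
    (hXZ : IndepFun X Z P) (hf : Measurable f) (hint : Integrable (fun ω => f (X ω, Z ω)) P) :
    P[fun ω => f (X ω, Z ω) | mE.comap X] =ᵐ[P] fun ω => ∫ z, f (X ω, z) ∂(P.map Z) := by
  have hlaw := (indepFun_iff_map_prod_eq_prod_map_map hX.aemeasurable hZ.aemeasurable).1 hXZ
  have : IsProbabilityMeasure (P.map X) := Measure.isProbabilityMeasure_map hX.aemeasurable
  have : IsProbabilityMeasure (P.map Z) := Measure.isProbabilityMeasure_map hZ.aemeasurable
  have hfint : Integrable f ((P.map X).prod (P.map Z)) := by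
    rw [← hlaw, integrable_map_measure hf.aestronglyMeasurable (hX.prodMk hZ).aemeasurable]
    exact hint
  have hφm : StronglyMeasurable fun x => ∫ z, f (x, z) ∂(P.map Z) :=
    hf.stronglyMeasurable.integral_prod_right'
  have hφint : Integrable (fun ω => ∫ z, f (X ω, z) ∂(P.map Z)) P :=
    hfint.integral_prod_left.comp_measurable hX
  refine (ae_eq_condExp_of_forall_setIntegral_eq hX.comap_le hint
    (fun _ _ _ => hφint.integrableOn) ?_ ?_).symm
  -- On an event `X ∈ B` both integrals are the integral of `f` over `B ×ˢ univ` for the product law.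
  · rintro _ ⟨B, hB, rfl⟩ -
    have h1 := setIntegral_map (μ := P) (g := X) hB hφm.aestronglyMeasurable hX.aemeasurable
    have h2 := setIntegral_map (μ := P) (g := fun ω => (X ω, Z ω))
      (hB.prod (MeasurableSet.univ (α := F))) hf.aestronglyMeasurable (hX.prodMk hZ).aemeasurable
    have h3 : (fun ω => (X ω, Z ω)) ⁻¹' (B ×ˢ Set.univ) = X ⁻¹' B := by ext; simp
    rw [h3, hlaw, setIntegral_prod _ hfint.integrableOn] at h2
    rw [← h1, ← h2]
    simp
  · exact (hφm.comp_measurable (comap_measurable X)).aestronglyMeasurable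

lemma identDistrib_prodMk_resample (hX : Measurable X) (hZ : Measurable Z) (hZ' : Measurable Z')
    (hXZ : IndepFun X Z P) (hXZZ' : IndepFun (fun ω => (X ω, Z ω)) Z' P)
    (hZZ' : IdentDistrib Z' Z P P) :
    IdentDistrib (fun ω => (X ω, Z' ω)) (fun ω => (X ω, Z ω)) P P := by
  refine ⟨by fun_prop, by fun_prop, ?_⟩
  have hXZ' : IndepFun X Z' P := hXZZ'.comp measurable_fst measurable_id
  rw [(indepFun_iff_map_prod_eq_prod_map_map hX.aemeasurable hZ.aemeasurable).1 hXZ,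
    (indepFun_iff_map_prod_eq_prod_map_map hX.aemeasurable hZ'.aemeasurable).1 hXZ', hZZ'.map_eq]

/-- The pick-freeze identity: given `X`, the two outputs are independent with the same conditional
mean, so their covariance is the variance of that conditional mean. -/
lemma covariance_pickFreeze (hX : Measurable X) (hZ : Measurable Z) (hZ' : Measurable Z')
    (hXZ : IndepFun X Z P) (hXZZ' : IndepFun (fun ω => (X ω, Z ω)) Z' P)
    (hZZ' : IdentDistrib Z' Z P P)
    (hf : Measurable f) (hL : MemLp (fun ω => f (X ω, Z ω)) 2 P) :
    cov[fun ω => f (X ω, Z ω), fun ω => f (X ω, Z' ω); P]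
      = Var[P[fun ω => f (X ω, Z ω) | mE.comap X]; P] := by
  have hid := (identDistrib_prodMk_resample hX hZ hZ' hXZ hXZZ' hZZ').comp hf
  have hL' : MemLp (fun ω => f (X ω, Z' ω)) 2 P := hid.memLp_iff.2 hL
  have hlaw := (indepFun_iff_map_prod_eq_prod_map_map hX.aemeasurable hZ.aemeasurable).1 hXZ
  have hlaw' := (indepFun_iff_map_prod_eq_prod_map_map (hX.prodMk hZ).aemeasurable
    hZ'.aemeasurable).1 hXZZ'
  rw [hlaw, hZZ'.map_eq] at hlaw'
  have hce := condExp_comp_prodMk_ae_eq_of_indepFun hX hZ hXZ hf (hL.integrable one_le_two)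
  have : IsProbabilityMeasure (P.map X) := Measure.isProbabilityMeasure_map hX.aemeasurable
  have : IsProbabilityMeasure (P.map Z) := Measure.isProbabilityMeasure_map hZ.aemeasurable
  set ν := P.map Z
  have hφm : StronglyMeasurable fun x => ∫ z, f (x, z) ∂ν :=
    hf.stronglyMeasurable.integral_prod_right'
  have hgm : Measurable fun p : (E × F) × F => f p.1 * f (p.1.1, p.2) := by fun_prop
  have hgint : Integrable (fun p : (E × F) × F => f p.1 * f (p.1.1, p.2))
      (((P.map X).prod ν).prod ν) := by
    rw [← hlaw', integrable_map_measure hgm.aestronglyMeasurable (by fun_prop)]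
    exact hL.integrable_mul hL'
  have hmul : ∫ ω, f (X ω, Z ω) * f (X ω, Z' ω) ∂P
      = ∫ ω, (∫ z, f (X ω, z) ∂ν) ^ 2 ∂P := by
    have h1 := integral_map (μ := P) (φ := fun ω => ((X ω, Z ω), Z' ω)) (by fun_prop)
      hgm.aestronglyMeasurable
    have h2 := integral_map (μ := P) (φ := X) (by fun_prop)
      (hφm.pow 2).aestronglyMeasurable
    simp only [Pi.pow_apply] at h2
    rw [← h1, ← h2, hlaw', integral_prod _ hgint]
    have h3 := hgint.integral_prod_left
    simp only [integral_const_mul] at h3 ⊢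
    rw [integral_prod _ h3]
    simp only [integral_mul_const, sq]
  have hmean : ∫ ω, f (X ω, Z' ω) ∂P = ∫ ω, f (X ω, Z ω) ∂P := hid.integral_eq
  rw [covariance_eq_sub hL hL', variance_eq_sub (hL.condExp one_le_two), integral_condExp hX.comap_le]
  simp only [Pi.mul_apply, hmul, hmean, sq (∫ ω, f (X ω, Z ω) ∂P)]
  congr 1
  refine integral_congr_ae ?_
  filter_upwards [hce] with ω h
  simp [h]

end PickFreeze

/-! ### The estimators on an i.i.d. sample of pairs -/

section PairedSample

lemma empMean_add (a b : ℕ → ℝ) (N : ℕ) :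
    empMean (fun i => a i + b i) N = empMean a N + empMean b N := by
  simp only [empMean, Finset.sum_add_distrib, mul_add]

lemma empMean_sub (a b : ℕ → ℝ) (N : ℕ) :
    empMean (fun i => a i - b i) N = empMean a N - empMean b N := by
  simp only [empMean, Finset.sum_sub_distrib, mul_sub]

lemma empMean_const_mul (c : ℝ) (a : ℕ → ℝ) (N : ℕ) :
    empMean (fun i => c * a i) N = c * empMean a N := by
  simp only [empMean, ← Finset.mul_sum]
  ring

lemma empMean_const (c : ℝ) {N : ℕ} (hN : N ≠ 0) : empMean (fun _ => c) N = c := by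
  simp only [empMean, Finset.sum_const, Finset.card_range, nsmul_eq_mul]
  field_simp

/-- The error of the numerator of `estimatorS`, up to quadratic terms in the centred means. The
centring `m` is arbitrary. -/
lemma estimatorS_num_sub (y z : ℕ → ℝ) (m s : ℝ) {N : ℕ} (hN : N ≠ 0) :
    (empMean (fun i => y i * z i) N - empMean y N * empMean z N)
        - s * (empMean (fun i => y i ^ 2) N - empMean y N ^ 2)
      = empMean (fun i => (y i - m) * ((z i - m) - s * (y i - m))) N
        + (s * empMean (fun i => y i - m) N ^ 2
          - empMean (fun i => y i - m) N * empMean (fun i => z i - m) N) := by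
  have e : (fun i => (y i - m) * ((z i - m) - s * (y i - m))) = fun i =>
      (y i * z i - s * y i ^ 2) + ((2 * s * m - m) * y i - m * z i) + (m ^ 2 - s * m ^ 2) := by
    ext i; ring
  simp only [e, empMean_add, empMean_sub, empMean_const_mul, empMean_const _ hN]
  ring

/-- The error of the numerator of `estimatorT`, up to quadratic terms in the centred means. The
centring `m` is arbitrary. -/
lemma estimatorT_num_sub (y z : ℕ → ℝ) (m s : ℝ) {N : ℕ} (hN : N ≠ 0) :
    (empMean (fun i => y i * z i) N - empMean (fun i => (y i + z i) / 2) N ^ 2)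
        - s * (empMean (fun i => (y i ^ 2 + z i ^ 2) / 2) N
          - empMean (fun i => (y i + z i) / 2) N ^ 2)
      = empMean (fun i => (y i - m) * (z i - m) - s / 2 * ((y i - m) ^ 2 + (z i - m) ^ 2)) N
        + (s - 1) / 4 * (empMean (fun i => y i - m) N + empMean (fun i => z i - m) N) ^ 2 := by
  have e : (fun i => (y i - m) * (z i - m) - s / 2 * ((y i - m) ^ 2 + (z i - m) ^ 2)) = fun i =>
      (y i * z i - s / 2 * (y i ^ 2 + z i ^ 2)) + (s * m - m) * (y i + z i)
        + (m ^ 2 - s * m ^ 2) := by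
    ext i; ring
  have e1 : (fun i => (y i + z i) / 2) = fun i => 1 / 2 * (y i + z i) := by ext i; ring
  have e2 : (fun i => (y i ^ 2 + z i ^ 2) / 2) = fun i => 1 / 2 * (y i ^ 2 + z i ^ 2) := by
    ext i; ring
  simp only [e, e1, e2, empMean_add, empMean_sub, empMean_const_mul, empMean_const _ hN]
  ring

variable {Ω₀ Ω : Type*} [MeasurableSpace Ω₀] [MeasurableSpace Ω]
  {P₀ : Measure Ω₀} {P : Measure Ω} {Y YX : Ω₀ → ℝ} {y yX : ℕ → Ω → ℝ}

/-- A statistic computed on each member of an i.i.d. sample of pairs is itself an i.i.d. sample. -/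
lemma iid_comp_pair (hindep : iIndepFun (fun i ω => (y i ω, yX i ω)) P)
    (hident : ∀ i, IdentDistrib (fun ω => (y i ω, yX i ω)) (fun ω => (Y ω, YX ω)) P P₀)
    {g : ℝ → ℝ → ℝ} (hg : Measurable fun p : ℝ × ℝ => g p.1 p.2) :
    iIndepFun (fun i ω => g (y i ω) (yX i ω)) P ∧
      (∀ i, IdentDistrib (fun ω => g (y i ω) (yX i ω)) (fun ω => g (Y ω) (YX ω)) P P₀) ∧
      ∀ i, IdentDistrib (fun ω => g (y i ω) (yX i ω)) (fun ω => g (y 0 ω) (yX 0 ω)) P P :=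
  ⟨hindep.comp (fun _ p => g p.1 p.2) fun _ => hg, fun i => (hident i).comp hg,
    fun i => ((hident i).trans (hident 0).symm).comp hg⟩

/-- A statistic of an i.i.d. sample of pairs obeys the strong law of large numbers. -/
lemma ae_tendsto_empMean_pair [IsProbabilityMeasure P]
    (hindep : iIndepFun (fun i ω => (y i ω, yX i ω)) P)
    (hident : ∀ i, IdentDistrib (fun ω => (y i ω, yX i ω)) (fun ω => (Y ω, YX ω)) P P₀)
    {g : ℝ → ℝ → ℝ} (hg : Measurable fun p : ℝ × ℝ => g p.1 p.2)
    (hint : Integrable (fun ω => g (Y ω) (YX ω)) P₀) :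
    ∀ᵐ ω ∂P, Tendsto (fun N => empMean (fun i => g (y i ω) (yX i ω)) N) atTop
      (nhds (∫ ω, g (Y ω) (YX ω) ∂P₀)) := by
  obtain ⟨h1, h2, h3⟩ := iid_comp_pair hindep hident hg
  rw [← (h2 0).integral_eq]
  exact ae_tendsto_empMean ((h2 0).integrable_iff.2 hint) h1 h3

lemma memLp_four_mul {A B : Ω₀ → ℝ} (hA : MemLp A 4 P₀) (hB : MemLp B 4 P₀) :
    MemLp (fun ω => A ω * B ω) 2 P₀ := by
  have : ENNReal.HolderTriple 4 4 2 := ⟨by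
    rw [← two_mul, show (4 : ENNReal) = 2 * 2 by norm_num,
      ENNReal.mul_inv (by simp) (by simp), ← mul_assoc,
      ENNReal.mul_inv_cancel (by simp) (by simp), one_mul]⟩
  exact hB.mul' hA

lemma aemeasurable_empMean_pair
    (hident : ∀ i, IdentDistrib (fun ω => (y i ω, yX i ω)) (fun ω => (Y ω, YX ω)) P P₀)
    {g : ℝ → ℝ → ℝ} (hg : Measurable fun p : ℝ × ℝ => g p.1 p.2) (N : ℕ) :
    AEMeasurable (fun ω => empMean (fun i => g (y i ω) (yX i ω)) N) P :=
  aemeasurable_empMean (fun i => ((hident i).comp hg).aemeasurable_fst) N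

variable [IsProbabilityMeasure P₀] [IsProbabilityMeasure P]

lemma tendstoInMeasure_sqrt_mul_quadratic
    (hindep : iIndepFun (fun i ω => (y i ω, yX i ω)) P)
    (hident : ∀ i, IdentDistrib (fun ω => (y i ω, yX i ω)) (fun ω => (Y ω, YX ω)) P P₀)
    (hY : MemLp Y 2 P₀) (hYX : MemLp YX 2 P₀) (hmean : P₀[YX] = P₀[Y])
    {r : ℕ → Ω → ℝ} (hr : ∀ N, AEMeasurable (r N) P) (C : ℝ)
    (hle : ∀ N ω, |r N ω| ≤ C * (empMean (fun i => y i ω - P₀[Y]) N ^ 2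
      + empMean (fun i => yX i ω - P₀[Y]) N ^ 2)) :
    TendstoInMeasure P (fun (N : ℕ) ω => √(N : ℝ) * r N ω) atTop (fun _ => 0) := by
  obtain ⟨hU1, hU2, hU3⟩ := iid_comp_pair hindep hident (g := fun a _ => a - P₀[Y])
    (by fun_prop)
  obtain ⟨hV1, hV2, hV3⟩ := iid_comp_pair hindep hident (g := fun _ b => b - P₀[Y])
    (by fun_prop)
  refine tendstoInMeasure_sqrt_mul_of_abs_le
    ((hU2 0).memLp_iff.2 (hY.sub (memLp_const _))) ?_ hU1 hU3
    ((hV2 0).memLp_iff.2 (hYX.sub (memLp_const _))) ?_ hV1 hV3 hr C hle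
  · rw [(hU2 0).integral_eq, integral_sub (hY.integrable one_le_two) (integrable_const _)]
    simp
  · rw [(hV2 0).integral_eq, integral_sub (hYX.integrable one_le_two) (integrable_const _)]
    simp [hmean]

/-- `tendstoInDistribution_sqrt_mul_div_sub` for statistics of an i.i.d. sample of pairs, with a
remainder quadratic in the centred empirical means. -/
theorem tendstoInDistribution_sqrt_mul_div_sub_pair
    (hindep : iIndepFun (fun i ω => (y i ω, yX i ω)) P)
    (hident : ∀ i, IdentDistrib (fun ω => (y i ω, yX i ω)) (fun ω => (Y ω, YX ω)) P P₀)
    (hY : MemLp Y 2 P₀) (hYX : MemLp YX 2 P₀) (hmean : P₀[YX] = P₀[Y])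
    {w : ℝ → ℝ → ℝ} (hw : Measurable fun p : ℝ × ℝ => w p.1 p.2)
    (hwL : MemLp (fun ω => w (Y ω) (YX ω)) 2 P₀) (hw0 : ∫ ω, w (Y ω) (YX ω) ∂P₀ = 0)
    {num den r : ℕ → Ω → ℝ} {s d : ℝ}
    (hnum : ∀ N, AEMeasurable (num N) P) (hden : ∀ N, AEMeasurable (den N) P)
    (hr : ∀ N, AEMeasurable (r N) P) (hd : d ≠ 0)
    (hlim : ∀ᵐ ω ∂P, Tendsto (fun N => den N ω) atTop (nhds d)) (C : ℝ)
    (hle : ∀ N ω, |r N ω| ≤ C * (empMean (fun i => y i ω - P₀[Y]) N ^ 2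
      + empMean (fun i => yX i ω - P₀[Y]) N ^ 2))
    (heq : ∀ N ω, N ≠ 0 →
      num N ω - s * den N ω = empMean (fun i => w (y i ω) (yX i ω)) N + r N ω) :
    TendstoInDistribution (fun (N : ℕ) ω => √(N : ℝ) * (num N ω / den N ω - s))
      atTop (id : ℝ → ℝ) (fun _ => P)
      (gaussianReal 0 (Var[fun ω => w (Y ω) (YX ω); P₀] / d ^ 2).toNNReal) := by
  obtain ⟨h1, h2, h3⟩ := iid_comp_pair hindep hident hw
  rw [← (h2 0).variance_eq]
  exact tendstoInDistribution_sqrt_mul_div_sub (W := fun i ω => w (y i ω) (yX i ω))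
    ((h2 0).memLp_iff.2 hwL) ((h2 0).integral_eq.trans hw0) h1 h3 hnum hden hr hd hlim
    (tendstoInMeasure_sqrt_mul_quadratic hindep hident hY hYX hmean hr C hle) heq

/-- Asymptotic normality of `estimatorS` needs only the first two moments of the pair `(Y, YX)`, up to
integrability: equal means and `Cov(Y, YX) = s Var Y`. -/
theorem tendstoInDistribution_estimatorS
    (hindep : iIndepFun (fun i ω => (y i ω, yX i ω)) P)
    (hident : ∀ i, IdentDistrib (fun ω => (y i ω, yX i ω)) (fun ω => (Y ω, YX ω)) P P₀)
    (hY : MemLp Y 4 P₀) (hYX : MemLp YX 4 P₀) (hmean : P₀[YX] = P₀[Y])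
    (hVar : Var[Y; P₀] ≠ 0) {s : ℝ} (hcov : cov[Y, YX; P₀] = s * Var[Y; P₀]) :
    TendstoInDistribution
      (fun (N : ℕ) (ω : Ω) => √(N : ℝ) * (estimatorS (fun i => y i ω) (fun i => yX i ω) N - s))
      atTop (id : ℝ → ℝ) (fun _ => P) (gaussianReal 0 (sigmaSqS P₀ Y YX s).toNNReal) := by
  have hY2 : MemLp Y 2 P₀ := hY.mono_exponent (by norm_num)
  have hYX2 : MemLp YX 2 P₀ := hYX.mono_exponent (by norm_num)
  have hVar_eq := variance_eq_integral hY.aemeasurable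
  have hcov_eq : cov[Y, YX; P₀] = ∫ ω, (Y ω - P₀[Y]) * (YX ω - P₀[Y]) ∂P₀ := by
    rw [covariance, hmean]
  have hlim : ∀ᵐ ω ∂P, Tendsto
      (fun N => empMean (fun i => y i ω ^ 2) N - empMean (fun i => y i ω) N ^ 2) atTop
      (nhds Var[Y; P₀]) := by
    filter_upwards [ae_tendsto_empMean_pair hindep hident (g := fun a _ => a ^ 2) (by fun_prop)
      hY2.integrable_sq, ae_tendsto_empMean_pair hindep hident (g := fun a _ => a) (by fun_prop)
      (hY2.integrable one_le_two)] with ω h1 h2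
    rw [variance_eq_sub hY2]
    exact h1.sub (h2.pow 2)
  unfold sigmaSqS estimatorS
  have hc : MemLp (fun ω => Y ω - P₀[Y]) 4 P₀ := hY.sub (memLp_const _)
  have hcX : MemLp (fun ω => YX ω - P₀[Y]) 4 P₀ := hYX.sub (memLp_const _)
  have hmeas {g : ℝ → ℝ → ℝ} (hg : Measurable fun p : ℝ × ℝ => g p.1 p.2) :=
    aemeasurable_empMean_pair hident hg
  have hmy := hmeas (g := fun a _ => a) (by fun_prop)
  have hmx := hmeas (g := fun _ b => b) (by fun_prop)
  have hmp := hmeas (g := fun a b => a * b) (by fun_prop)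
  have hmq := hmeas (g := fun a _ => a ^ 2) (by fun_prop)
  generalize hm : P₀[Y] = m at *
  have hmU := hmeas (g := fun a _ => a - m) (by fun_prop)
  have hmV := hmeas (g := fun _ b => b - m) (by fun_prop)
  have hsq : Integrable (fun ω => (Y ω - m) ^ 2) P₀ := by
    simpa only [sq] using (memLp_four_mul hc hc).integrable one_le_two
  have hw0 : ∫ ω, (Y ω - m) * ((YX ω - m) - s * (Y ω - m)) ∂P₀ = 0 := by
    have e : (fun ω => (Y ω - m) * ((YX ω - m) - s * (Y ω - m))) =
        fun ω => (Y ω - m) * (YX ω - m) - s * (Y ω - m) ^ 2 := by ext ω; ring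
    rw [e, integral_sub ((memLp_four_mul hc hcX).integrable one_le_two) (hsq.const_mul s),
      integral_const_mul, ← hVar_eq, ← hcov_eq, hcov, sub_self]
  refine tendstoInDistribution_sqrt_mul_div_sub_pair hindep hident hY2 hYX2 (by rw [hm, hmean])
    (w := fun a b => (a - m) * ((b - m) - s * (a - m))) (by fun_prop)
    (memLp_four_mul hc (hcX.sub (hc.const_mul s))) hw0
    (num := fun N ω => empMean (fun i => y i ω * yX i ω) N
      - empMean (fun i => y i ω) N * empMean (fun i => yX i ω) N)
    (den := fun N ω => empMean (fun i => y i ω ^ 2) N - empMean (fun i => y i ω) N ^ 2)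
    (r := fun N ω => s * empMean (fun i => y i ω - m) N ^ 2
      - empMean (fun i => y i ω - m) N * empMean (fun i => yX i ω - m) N)
    (fun N => (hmp N).sub ((hmy N).mul (hmx N))) (fun N => (hmq N).sub ((hmy N).pow_const 2))
    (fun N => (((hmU N).pow_const 2).const_mul s).sub ((hmU N).mul (hmV N)))
    hVar hlim (1 + |s|) ?_ fun N ω hN => estimatorS_num_sub _ _ m s hN
  intro N ω
  rw [hm]
  generalize empMean (fun i => y i ω - m) N = a
  generalize empMean (fun i => yX i ω - m) N = b
  -- `|s a² - a b| ≤ |s| a² + (a² + b²) / 2`.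
  have h1 := abs_le.1 (le_refl |s|)
  rw [abs_le]
  constructor <;> nlinarith [sq_nonneg (a - b), sq_nonneg (a + b), sq_nonneg a, sq_nonneg b,
    mul_nonneg (abs_nonneg s) (sq_nonneg b), mul_le_mul_of_nonneg_right h1.1 (sq_nonneg a),
    mul_le_mul_of_nonneg_right h1.2 (sq_nonneg a)]

/-- Since `estimatorT` pools both outputs in its denominator, equality of their variances is needed on
top of the moment conditions for `estimatorS`. -/
theorem tendstoInDistribution_estimatorT
    (hindep : iIndepFun (fun i ω => (y i ω, yX i ω)) P)
    (hident : ∀ i, IdentDistrib (fun ω => (y i ω, yX i ω)) (fun ω => (Y ω, YX ω)) P P₀)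
    (hY : MemLp Y 4 P₀) (hYX : MemLp YX 4 P₀) (hmean : P₀[YX] = P₀[Y])
    (hVar : Var[Y; P₀] ≠ 0) (hVarX : Var[YX; P₀] = Var[Y; P₀]) {s : ℝ}
    (hcov : cov[Y, YX; P₀] = s * Var[Y; P₀]) :
    TendstoInDistribution
      (fun (N : ℕ) (ω : Ω) => √(N : ℝ) * (estimatorT (fun i => y i ω) (fun i => yX i ω) N - s))
      atTop (id : ℝ → ℝ) (fun _ => P) (gaussianReal 0 (sigmaSqT P₀ Y YX s).toNNReal) := by
  have hY2 : MemLp Y 2 P₀ := hY.mono_exponent (by norm_num)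
  have hYX2 : MemLp YX 2 P₀ := hYX.mono_exponent (by norm_num)
  have hVar_eq := variance_eq_integral hY.aemeasurable
  have hVarX_eq : Var[YX; P₀] = ∫ ω, (YX ω - P₀[Y]) ^ 2 ∂P₀ := by
    rw [variance_eq_integral hYX.aemeasurable, hmean]
  have hcov_eq : cov[Y, YX; P₀] = ∫ ω, (Y ω - P₀[Y]) * (YX ω - P₀[Y]) ∂P₀ := by
    rw [covariance, hmean]
  have hlim : ∀ᵐ ω ∂P, Tendsto
      (fun N => empMean (fun i => (y i ω ^ 2 + yX i ω ^ 2) / 2) N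
        - empMean (fun i => (y i ω + yX i ω) / 2) N ^ 2) atTop (nhds Var[Y; P₀]) := by
    have hi1 := hY2.integrable one_le_two
    have hi2 := hYX2.integrable one_le_two
    have hV : Var[Y; P₀] = ∫ ω, (Y ω ^ 2 + YX ω ^ 2) / 2 ∂P₀
        - (∫ ω, (Y ω + YX ω) / 2 ∂P₀) ^ 2 := by
      have e1 := variance_eq_sub hY2
      have e2 := variance_eq_sub hYX2
      simp only [Pi.pow_apply] at e1 e2
      rw [integral_div, integral_div, integral_add hi1 hi2,
        integral_add hY2.integrable_sq hYX2.integrable_sq]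
      rw [hmean] at e2 ⊢
      linarith
    filter_upwards [ae_tendsto_empMean_pair hindep hident (g := fun a b => (a ^ 2 + b ^ 2) / 2)
      (by fun_prop) ((hY2.integrable_sq.add hYX2.integrable_sq).div_const 2),
      ae_tendsto_empMean_pair hindep hident (g := fun a b => (a + b) / 2) (by fun_prop)
      ((hi1.add hi2).div_const 2)] with ω h1 h2
    rw [hV]
    exact h1.sub (h2.pow 2)
  unfold sigmaSqT estimatorT
  have hc : MemLp (fun ω => Y ω - P₀[Y]) 4 P₀ := hY.sub (memLp_const _)
  have hcX : MemLp (fun ω => YX ω - P₀[Y]) 4 P₀ := hYX.sub (memLp_const _)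
  have hmeas {g : ℝ → ℝ → ℝ} (hg : Measurable fun p : ℝ × ℝ => g p.1 p.2) :=
    aemeasurable_empMean_pair hident hg
  have hmh := hmeas (g := fun a b => (a + b) / 2) (by fun_prop)
  have hmp := hmeas (g := fun a b => a * b) (by fun_prop)
  have hmq := hmeas (g := fun a b => (a ^ 2 + b ^ 2) / 2) (by fun_prop)
  generalize hm : P₀[Y] = m at *
  have hmU := hmeas (g := fun a _ => a - m) (by fun_prop)
  have hmV := hmeas (g := fun _ b => b - m) (by fun_prop)
  have hsq : MemLp (fun ω => (Y ω - m) ^ 2) 2 P₀ := by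
    simpa only [sq] using memLp_four_mul hc hc
  have hsqX : MemLp (fun ω => (YX ω - m) ^ 2) 2 P₀ := by
    simpa only [sq] using memLp_four_mul hcX hcX
  have hsum : MemLp (fun ω => s / 2 * ((Y ω - m) ^ 2 + (YX ω - m) ^ 2)) 2 P₀ :=
    (hsq.add hsqX).const_mul (s / 2)
  have hw0 : ∫ ω, ((Y ω - m) * (YX ω - m) - s / 2 * ((Y ω - m) ^ 2 + (YX ω - m) ^ 2)) ∂P₀
      = 0 := by
    rw [integral_sub ((memLp_four_mul hc hcX).integrable one_le_two) (hsum.integrable one_le_two),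
      integral_const_mul, integral_add (hsq.integrable one_le_two) (hsqX.integrable one_le_two),
      ← hVar_eq, ← hcov_eq, ← hVarX_eq, hcov, hVarX]
    ring
  refine tendstoInDistribution_sqrt_mul_div_sub_pair hindep hident hY2 hYX2 (by rw [hm, hmean])
    (w := fun a b => (a - m) * (b - m) - s / 2 * ((a - m) ^ 2 + (b - m) ^ 2)) (by fun_prop)
    ((memLp_four_mul hc hcX).sub hsum) hw0
    (num := fun N ω => empMean (fun i => y i ω * yX i ω) N
      - empMean (fun i => (y i ω + yX i ω) / 2) N ^ 2)
    (den := fun N ω => empMean (fun i => (y i ω ^ 2 + yX i ω ^ 2) / 2) N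
      - empMean (fun i => (y i ω + yX i ω) / 2) N ^ 2)
    (r := fun N ω => (s - 1) / 4 *
      (empMean (fun i => y i ω - m) N + empMean (fun i => yX i ω - m) N) ^ 2)
    (fun N => (hmp N).sub ((hmh N).pow_const 2)) (fun N => (hmq N).sub ((hmh N).pow_const 2))
    (fun N => (((hmU N).add (hmV N)).pow_const 2).const_mul _)
    hVar hlim (|s - 1| / 2) ?_ fun N ω hN => estimatorT_num_sub _ _ m s hN
  intro N ω
  rw [hm]
  generalize empMean (fun i => y i ω - m) N = a
  generalize empMean (fun i => yX i ω - m) N = b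
  -- `(a + b)² ≤ 2 (a² + b²)`.
  rw [abs_mul, abs_div, abs_of_nonneg (sq_nonneg (a + b)), abs_of_pos (four_pos (α := ℝ))]
  nlinarith [mul_nonneg (abs_nonneg (s - 1)) (sq_nonneg (a - b))]

end PairedSample

/-! ### Asymptotic normality -/

lemma memLp_four_of_integrable_pow {Ω : Type*} [MeasurableSpace Ω] {P : Measure Ω} {Y : Ω → ℝ}
    (hY : AEStronglyMeasurable Y P) (h : Integrable (fun ω => Y ω ^ 4) P) : MemLp Y 4 P := by
  refine (integrable_norm_rpow_iff hY (by norm_num) (by norm_num)).1 ?_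
  refine h.congr (ae_of_all _ fun ω => ?_)
  have e : (4 : ENNReal).toReal = ((4 : ℕ) : ℝ) := by norm_num
  simp only [e, Real.rpow_natCast, Real.norm_eq_abs]
  exact ((by decide : Even 4).pow_abs _).symm

theorem mainTheorem1
    {Ω₀ Ω E F : Type*} [MeasurableSpace Ω₀] [MeasurableSpace Ω]
    [MeasurableSpace E] [MeasurableSpace F]
    -- the model: independent inputs `X`, `Z`, a copy `Z'` of `Z` independent of `(X, Z)`,
    -- and the outputs `Y = f (X, Z)`, `Y^X = f (X, Z')`
    (P₀ : Measure Ω₀) [IsProbabilityMeasure P₀]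
    (X : Ω₀ → E) (Z Z' : Ω₀ → F)
    (hX : Measurable X) (hZ : Measurable Z) (hZ' : Measurable Z')
    (hXZ : IndepFun X Z P₀)
    (hXZZ' : IndepFun (fun ω => (X ω, Z ω)) Z' P₀)
    (hZZ' : IdentDistrib Z' Z P₀ P₀)
    (f : E × F → ℝ) (hf : Measurable f)
    (Y YX : Ω₀ → ℝ)
    (hY : Y = fun ω => f (X ω, Z ω))
    (hYX : YX = fun ω => f (X ω, Z' ω))
    (hVar : Var[Y; P₀] ≠ 0)
    (hY4 : Integrable (fun ω => Y ω ^ 4) P₀)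
    -- the sample: independent copies of `(X, Z, Z')`
    (P : Measure Ω) [IsProbabilityMeasure P]
    (Xs : ℕ → Ω → E) (Zs Zs' : ℕ → Ω → F)
    (hindep : iIndepFun (fun i ω => (Xs i ω, Zs i ω, Zs' i ω)) P)
    (hident : ∀ i, IdentDistrib (fun ω => (Xs i ω, Zs i ω, Zs' i ω))
      (fun ω => (X ω, Z ω, Z' ω)) P P₀) :
    TendstoInDistribution
      (fun (N : ℕ) (ω : Ω) => √(N : ℝ) *
        (estimatorS (fun i => f (Xs i ω, Zs i ω)) (fun i => f (Xs i ω, Zs' i ω)) N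
          - sobolIndex P₀ X Y))
      atTop (id : ℝ → ℝ) (fun _ => P)
      (gaussianReal 0 (sigmaSqS P₀ Y YX (sobolIndex P₀ X Y)).toNNReal)
    ∧ TendstoInDistribution
      (fun (N : ℕ) (ω : Ω) => √(N : ℝ) *
        (estimatorT (fun i => f (Xs i ω, Zs i ω)) (fun i => f (Xs i ω, Zs' i ω)) N
          - sobolIndex P₀ X Y))
      atTop (id : ℝ → ℝ) (fun _ => P)
      (gaussianReal 0 (sigmaSqT P₀ Y YX (sobolIndex P₀ X Y)).toNNReal) := by
  subst hY hYX
  have hm : Measurable fun ω => f (X ω, Z ω) := hf.comp (hX.prodMk hZ)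
  have hL4 : MemLp (fun ω => f (X ω, Z ω)) 4 P₀ :=
    memLp_four_of_integrable_pow hm.aestronglyMeasurable hY4
  have hid : IdentDistrib (fun ω => f (X ω, Z' ω)) (fun ω => f (X ω, Z ω)) P₀ P₀ :=
    (identDistrib_prodMk_resample hX hZ hZ' hXZ hXZZ' hZZ').comp hf
  have hcov : cov[fun ω => f (X ω, Z ω), fun ω => f (X ω, Z' ω); P₀]
      = sobolIndex P₀ X (fun ω => f (X ω, Z ω)) * Var[fun ω => f (X ω, Z ω); P₀] := by
    rw [sobolIndex, div_mul_cancel₀ _ hVar]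
    exact covariance_pickFreeze hX hZ hZ' hXZ hXZZ' hZZ' hf (hL4.mono_exponent (by norm_num))
  have hout : Measurable fun p : E × F × F => (f (p.1, p.2.1), f (p.1, p.2.2)) := by fun_prop
  have hindep' := hindep.comp (fun _ p => (f (p.1, p.2.1), f (p.1, p.2.2))) fun _ => hout
  have hident' i := (hident i).comp hout
  exact ⟨tendstoInDistribution_estimatorS hindep' hident' hL4 (hid.memLp_iff.2 hL4)
      hid.integral_eq hVar hcov,
    tendstoInDistribution_estimatorT hindep' hident' hL4 (hid.memLp_iff.2 hL4)
      hid.integral_eq hVar hid.variance_eq hcov⟩
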